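/- Let $n\ge 3$ and regard $\mathbb P^n$ as the $n$-dimensional complex projective space. A (singular holomorphic) distribution $\mathcal D$ of dimension $r$ on $\mathbb P^n$ is a coherent subsheaf $T\mathcal D$ of rank $r$ of the tangent sheaf $T\mathbb P^n$, called its tangent sheaf; its singular set $\mathrm{Sing}(\mathcal D)$ is the set of points $p$ at which the stalk $(T\mathbb P^n/T\mathcal D)_p$ is not a free $\mathcal O_p$-module, and $\mathcal D$ is reduced if every holomorphic vector field on an open set $U$ whose germs at the points of $U\setminus\mathrm{Sing}(\mathcal D)$ lie in $T\mathcal D$ is a section of $T\mathcal D$ over $U$. If $\mathcal D$ is reduced of codimension $p=n-r$, it is given by a global section $\omega$ of $\Omega^{p}_{\mathbb P^n}(\ell)$ for some $\ell\in\mathbb Z$, meaning that at each point outside $\mathrm{Sing}(\mathcal D)$ the form $\omega$ is nonzero and decomposable with kernel the subspace tangent to $\mathcal D$; the degree $\deg(\mathcal D)$ is the degree of the divisor of zeros of the restriction of $\omega$ to a general linear subspace $\mathbb P^{p}\subset\mathbb P^n$. Let $(\mathcal F,\mathcal G)$ be a flag of reduced distributions on $\mathbb P^n$ with $\dim\mathcal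 F=k$ and $\mathcal G$ of codimension one; that is, $1\le k<n-1$ and $T\mathcal F\subset T\mathcal G$. Suppose that $\mathrm{codim}\,\mathrm{Sing}(\mathcal G)\ge n-k+1$ (a condition that holds if $\mathrm{Sing}(\mathcal G)$ is empty) and that $T\mathcal F$ is split, i.e. it is a direct sum of line bundles. Then $$\deg(\mathcal G)\le\deg(\mathcal F).$$ -/

import Mathlib

open Topology TopologicalSpace LinearAlgebra.Projectivization

noncomputable section

namespace ProjDist

/-- The space `ℂ^{n+1}` of homogeneous coordinates. -/
abbrev V (n : ℕ) : Type := Fin (n + 1) → ℂ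

/-- Complex projective space `ℙⁿ`, the set of lines through the origin of `ℂ^{n+1}`. -/
abbrev Pn (n : ℕ) : Type := ℙ ℂ (V n)

/-- The quotient topology for the projection `π : ℂ^{n+1} \ {0} → ℙⁿ`. -/
instance instTopPn (n : ℕ) : TopologicalSpace (Pn n) :=
  TopologicalSpace.coinduced (fun z : {z : V n // z ≠ 0} => Projectivization.mk' ℂ z) inferInstance

/-! ### Holomorphic functions and holomorphic vector fields on open subsets of `ℙⁿ` -/

/-- `f : U → ℂ` is holomorphic: `f ∘ π` is locally the restriction of an analytic function. -/
def IsHolo {n : ℕ} (U : Opens (Pn n)) (f : U → ℂ) : Prop :=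
  ∀ (z : V n) (hz : z ≠ 0), Projectivization.mk ℂ z hz ∈ U →
    ∃ g : V n → ℂ, AnalyticAt ℂ g z ∧
      ∀ᶠ w in 𝓝 z, ∀ (hw : w ≠ 0) (hU : Projectivization.mk ℂ w hw ∈ U), f ⟨_, hU⟩ = g w

/-- The ring `𝒪(U)` of holomorphic functions on `U`. -/
def holo {n : ℕ} (U : Opens (Pn n)) : Subring (U → ℂ) where
  carrier := {f | IsHolo U f}
  mul_mem' := by
    intro a b ha hb z hz hzU
    obtain ⟨g, hg, hge⟩ := ha z hz hzU
    obtain ⟨h, hh, hhe⟩ := hb z hz hzU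
    refine ⟨g * h, hg.mul hh, ?_⟩
    filter_upwards [hge, hhe] with w h1 h2 hw hU
    simp [h1 hw hU, h2 hw hU]
  one_mem' := fun z _ _ => ⟨fun _ => 1, analyticAt_const, by simp⟩
  add_mem' := by
    intro a b ha hb z hz hzU
    obtain ⟨g, hg, hge⟩ := ha z hz hzU
    obtain ⟨h, hh, hhe⟩ := hb z hz hzU
    refine ⟨g + h, hg.add hh, ?_⟩
    filter_upwards [hge, hhe] with w h1 h2 hw hU
    simp [h1 hw hU, h2 hw hU]
  zero_mem' := fun z _ _ => ⟨fun _ => 0, analyticAt_const, by simp⟩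
  neg_mem' := by
    intro a ha z hz hzU
    obtain ⟨g, hg, hge⟩ := ha z hz hzU
    refine ⟨-g, hg.neg, ?_⟩
    filter_upwards [hge] with w h1 hw hU
    simp [h1 hw hU]

/-- The holomorphic tangent space of `ℙⁿ` at the line `x`, namely `Hom(x, ℂ^{n+1} / x)`. -/
abbrev Tan {n : ℕ} (x : Pn n) : Type := x.submodule →ₗ[ℂ] (V n ⧸ x.submodule)

/-- `Lifts t z y`: the point `z` lies on the line `x`, and the tangent vector `t` at `x` sends `z`
to the class of `y`. For `z ≠ 0` this says that `t` is the image of the vector `y`, based at `z`,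
under the differential of `π`. -/
def Lifts {n : ℕ} {x : Pn n} (t : Tan x) (z y : V n) : Prop :=
  ∃ hz : z ∈ x.submodule, t ⟨z, hz⟩ = Submodule.Quotient.mk y

/-- A family of tangent vectors along `U` is a holomorphic vector field: locally on the cone over
`U` it is the image of an analytic vector field of `ℂ^{n+1}`. -/
def IsHoloField {n : ℕ} (U : Opens (Pn n)) (v : ∀ x : U, Tan (x : Pn n)) : Prop :=
  ∀ (z : V n) (hz : z ≠ 0), Projectivization.mk ℂ z hz ∈ U →
    ∃ g : V n → V n, AnalyticAt ℂ g z ∧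
      ∀ᶠ w in 𝓝 z, ∀ (hw : w ≠ 0) (hU : Projectivization.mk ℂ w hw ∈ U),
        Lifts (v ⟨_, hU⟩) w (g w)

/-- The `𝒪(U)`-module of holomorphic vector fields on `U`, i.e. the sections over `U` of the
tangent sheaf of `ℙⁿ`. -/
def fields {n : ℕ} (U : Opens (Pn n)) : Submodule (holo U) (∀ x : U, Tan (x : Pn n)) where
  carrier := {v | IsHoloField U v}
  add_mem' := by
    intro a b ha hb z hz hzU
    obtain ⟨g, hg, hge⟩ := ha z hz hzU
    obtain ⟨h, hh, hhe⟩ := hb z hz hzU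
    refine ⟨g + h, hg.add hh, ?_⟩
    filter_upwards [hge, hhe] with w h1 h2 hw hU
    obtain ⟨m, e1⟩ := h1 hw hU
    obtain ⟨_, e2⟩ := h2 hw hU
    refine ⟨m, ?_⟩
    rw [Pi.add_apply, LinearMap.add_apply, e1, e2, Pi.add_apply, Submodule.Quotient.mk_add]
  zero_mem' := by
    intro z hz hzU
    refine ⟨fun _ => 0, analyticAt_const, Filter.Eventually.of_forall fun w hw hU => ?_⟩
    refine ⟨?_, ?_⟩
    · rw [Projectivization.submodule_mk]
      exact Submodule.mem_span_singleton_self w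
    · rw [Submodule.Quotient.mk_zero]
      rfl
  smul_mem' := by
    intro c a ha z hz hzU
    obtain ⟨g, hg, hge⟩ := ha z hz hzU
    obtain ⟨h, hh, hhe⟩ := c.2 z hz hzU
    refine ⟨fun w => h w • g w, hh.smul hg, ?_⟩
    filter_upwards [hge, hhe] with w h1 h2 hw hU
    obtain ⟨m, e1⟩ := h1 hw hU
    refine ⟨m, ?_⟩
    rw [Submodule.Quotient.mk_smul, ← e1, ← h2 hw hU]
    rfl

instance instModuleFields {n : ℕ} (U : Opens (Pn n)) : Module (holo U) (fields U) :=
  (fields U).module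

instance instSMulFields {n : ℕ} (U : Opens (Pn n)) : SMul (holo U) (fields U) :=
  (instModuleFields U).toSMul

/-- Restriction of holomorphic functions. -/
def resFun {n : ℕ} {W U : Opens (Pn n)} (h : W ≤ U) (f : holo U) : holo W :=
  ⟨fun x => f.1 ⟨x.1, h x.2⟩, fun z hz hzW => by
    obtain ⟨g, hg, hge⟩ := f.2 z hz (h hzW)
    refine ⟨g, hg, ?_⟩
    filter_upwards [hge] with w h1 hw hU
    exact h1 hw (h hU)⟩

/-- Restriction of holomorphic vector fields. -/
def res {n : ℕ} {W U : Opens (Pn n)} (h : W ≤ U) (v : fields U) : fields W :=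
  ⟨fun x => v.1 ⟨x.1, h x.2⟩, fun z hz hzW => by
    obtain ⟨g, hg, hge⟩ := v.2 z hz (h hzW)
    refine ⟨g, hg, ?_⟩
    filter_upwards [hge] with w h1 hw hU
    exact h1 hw (h hU)⟩

/-! ### Subsheaves of the tangent sheaf -/

/-- A subsheaf of `𝒪`-modules of the tangent sheaf of `ℙⁿ`. -/
structure Subsheaf (n : ℕ) where
  /-- the sections over an open set -/
  sec : ∀ U : Opens (Pn n), Submodule (holo U) (fields U)
  res_mem : ∀ {W U : Opens (Pn n)} (h : W ≤ U) (σ : fields U), σ ∈ sec U → res h σ ∈ sec W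
  local_mem : ∀ (U : Opens (Pn n)) (σ : fields U),
    (∀ x ∈ U, ∃ (W : Opens (Pn n)) (h : W ≤ U), x ∈ W ∧ res h σ ∈ sec W) → σ ∈ sec U

namespace Subsheaf

variable {n : ℕ}

/-- `E` is locally finitely generated. -/
def LocallyFG (E : Subsheaf n) : Prop :=
  ∀ x : Pn n, ∃ (U : Opens (Pn n)) (m : ℕ) (v : Fin m → fields U), x ∈ U ∧
    (∀ i, v i ∈ E.sec U) ∧
    ∀ (W : Opens (Pn n)) (hWU : W ≤ U), ∀ σ ∈ E.sec W, ∀ y ∈ W,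
      ∃ (W' : Opens (Pn n)) (h : W' ≤ W) (f : Fin m → holo W'), y ∈ W' ∧
        res h σ = ∑ i, f i • res (h.trans hWU) (v i)

/-- `E` is free of rank `r` on a neighbourhood of `x`. -/
def FreeNear (E : Subsheaf n) (r : ℕ) (x : Pn n) : Prop :=
  ∃ (U : Opens (Pn n)) (e : Fin r → fields U), x ∈ U ∧ (∀ i, e i ∈ E.sec U) ∧
    ∀ (W : Opens (Pn n)) (hWU : W ≤ U), ∀ σ ∈ E.sec W,
      ∃! f : Fin r → holo W, σ = ∑ i, f i • res hWU (e i)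

/-- `E` is an invertible sheaf, i.e. the sheaf of sections of a holomorphic line bundle. -/
def Invertible (E : Subsheaf n) : Prop := ∀ x, E.FreeNear 1 x

/-- `E` is split: it is the direct sum of finitely many invertible sheaves. -/
def IsSplit (E : Subsheaf n) : Prop :=
  ∃ (m : ℕ) (L : Fin m → Subsheaf n), (∀ i, (L i).Invertible) ∧
    ∀ U : Opens (Pn n), iSupIndep (fun i => (L i).sec U) ∧ ⨆ i, (L i).sec U = E.sec U

/-- The stalk at `x` of the normal sheaf (the quotient of the tangent sheaf by `E`) is a free
module of finite rank: there are germs `w₁, …, w_q` of vector fields at `x` whose classes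
generate it and are linearly independent over the ring of germs of holomorphic functions. -/
def NormalFreeAt (E : Subsheaf n) (x : Pn n) : Prop :=
  ∃ (U : Opens (Pn n)) (q : ℕ) (w : Fin q → fields U), x ∈ U ∧
    (∀ (W : Opens (Pn n)) (hWU : W ≤ U), x ∈ W → ∀ σ : fields W,
      ∃ (W' : Opens (Pn n)) (h : W' ≤ W) (f : Fin q → holo W'), x ∈ W' ∧
        res h σ - ∑ i, f i • res (h.trans hWU) (w i) ∈ E.sec W') ∧
    (∀ (W : Opens (Pn n)) (hWU : W ≤ U), x ∈ W → ∀ f : Fin q → holo W,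
      ∑ i, f i • res hWU (w i) ∈ E.sec W →
        ∃ (W' : Opens (Pn n)) (h : W' ≤ W), x ∈ W' ∧ ∀ i, resFun h (f i) = 0)

/-- The singular set: the points where the stalk of the normal sheaf is not free. -/
def Sing (E : Subsheaf n) : Set (Pn n) := {x | ¬ E.NormalFreeAt x}

/-- `E` is full (saturated): a holomorphic vector field on `U` whose germs at the points of
`U \ Sing E` belong to `E` is a section of `E`. -/
def IsFull (E : Subsheaf n) : Prop :=
  ∀ (U : Opens (Pn n)) (σ : fields U),
    (∀ x ∈ U, x ∉ E.Sing → ∃ (W : Opens (Pn n)) (h : W ≤ U), x ∈ W ∧ res h σ ∈ E.sec W) →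
    σ ∈ E.sec U

/-- The set `E(x) = {v(x) : v ∈ E_x}` of values at `x` of the germs of sections of `E`. -/
def fiber (E : Subsheaf n) (x : Pn n) : Set (Tan x) :=
  {t | ∃ (U : Opens (Pn n)) (hx : x ∈ U), ∃ σ ∈ E.sec U, σ.1 ⟨x, hx⟩ = t}

end Subsheaf

/-! ### Distributions -/

/-- A singular holomorphic distribution of dimension `r` on `ℙⁿ`: a coherent subsheaf of rank `r`
of the tangent sheaf. -/
structure Distribution (n r : ℕ) where
  /-- the tangent sheaf of the distribution -/
  tangentSheaf : Subsheaf n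
  coherent : tangentSheaf.LocallyFG
  rank_eq : Dense {x | tangentSheaf.FreeNear r x}

/-- A reduced distribution is one whose tangent sheaf is full. -/
def Distribution.IsReduced {n r : ℕ} (D : Distribution n r) : Prop := D.tangentSheaf.IsFull

/-- The singular set of a distribution. -/
def Distribution.Sing {n r : ℕ} (D : Distribution n r) : Set (Pn n) := D.tangentSheaf.Sing

/-- `(F, G)` is a flag: `1 ≤ dim F < dim G < n` and the tangent sheaf of `F` is a subsheaf of the
tangent sheaf of `G`. -/
def IsFlag {n r s : ℕ} (F : Distribution n r) (G : Distribution n s) : Prop :=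
  1 ≤ r ∧ r < s ∧ s < n ∧ ∀ U : Opens (Pn n), F.tangentSheaf.sec U ≤ G.tangentSheaf.sec U

/-- The codimension in `ℙⁿ` of (the Zariski closure of) a subset: the height of the homogeneous
ideal of the polynomials that vanish on the cone over it. It is `⊤` for the empty set. -/
def codim {n : ℕ} (S : Set (Pn n)) : ℕ∞ :=
  (MvPolynomial.vanishingIdeal ℂ
    {z : V n | ∃ hz : z ≠ 0, Projectivization.mk ℂ z hz ∈ S}).height

/-! ### Twisted forms and the degree -/

/-- A global section of `Ω^p ⊗ 𝒪(l)` on `ℙⁿ`, as its pull-back to `ℂ^{n+1} \ {0}`: a holomorphic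
`p`-form with coefficients homogeneous of degree `l - p` which is annihilated by the contraction
with the radial vector field. (The value at `0` is irrelevant.) -/
structure TwistedForm (n p : ℕ) (l : ℤ) where
  /-- the form at each point of `ℂ^{n+1}` -/
  form : V n → (V n) [⋀^Fin p]→ₗ[ℂ] ℂ
  analytic : ∀ z : V n, z ≠ 0 → ∀ u : Fin p → V n, AnalyticAt ℂ (fun w => form w u) z
  homogeneous : ∀ (c : ℂ) (z : V n), c ≠ 0 → z ≠ 0 → form (c • z) = c ^ (l - p) • form z
  radial : ∀ z : V n, z ≠ 0 → ∀ u : Fin p → V n, (∃ i, u i = z) → form z u = 0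

/-- The distribution `D` is given by the twisted form `ω`: at each point `x` outside the singular
set, `ω` is a nonzero decomposable form `φ₁ ∧ ⋯ ∧ φ_p`, and the vectors tangent to `D` at `x` are
those annihilated by `φ₁, …, φ_p`. -/
def Distribution.GivenBy {n r p : ℕ} {l : ℤ} (D : Distribution n r) (ω : TwistedForm n p l) :
    Prop :=
  ∀ (z : V n) (hz : z ≠ 0), Projectivization.mk ℂ z hz ∉ D.Sing →
    ∃ φ : Fin p → Module.Dual ℂ (V n), LinearIndependent ℂ φ ∧
      (∀ u : Fin p → V n, ω.form z u = Matrix.det (Matrix.of fun i j => φ i (u j))) ∧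
      ∀ (t : Tan (Projectivization.mk ℂ z hz)) (y : V n), Lifts t z y →
        (t ∈ D.tangentSheaf.fiber (Projectivization.mk ℂ z hz) ↔ ∀ i, φ i y = 0)

/-- The tangency divisor of `ω` with a general linear `ℙ^p ⊂ ℙⁿ` has degree `d`. For a linear
immersion given by a matrix `A`, the pull-back of `ω` to `ℙ^p` is `g` times the generator
`i_ϑ (dw₀ ∧ ⋯ ∧ dw_p)`, and the tangency divisor is the divisor of the homogeneous polynomial `g`.
"General" means: for all `A` in the complement of some hypersurface `P = 0`. -/
def TwistedForm.TangencyDegree {n p : ℕ} {l : ℤ} (ω : TwistedForm n p l) (d : ℕ) : Prop :=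
  ∃ P : MvPolynomial (Fin (n + 1) × Fin (p + 1)) ℂ, P ≠ 0 ∧
    ∀ A : Matrix (Fin (n + 1)) (Fin (p + 1)) ℂ, MvPolynomial.eval (fun ij => A ij.1 ij.2) P ≠ 0 →
      Function.Injective A.mulVec ∧
      ∃ g : MvPolynomial (Fin (p + 1)) ℂ, g ≠ 0 ∧ g.IsHomogeneous d ∧
        ∀ (w : Fin (p + 1) → ℂ) (u : Fin p → Fin (p + 1) → ℂ), w ≠ 0 →
          ω.form (A.mulVec w) (fun j => A.mulVec (u j)) =
            MvPolynomial.eval w g *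
              Matrix.det (Matrix.of (Fin.cons w u : Fin (p + 1) → Fin (p + 1) → ℂ))

/-- The degree of the distribution `D`, of codimension `p`, is `d`: `D` is given by a section `ω`
of `Ω^p ⊗ 𝒪(l)` whose tangency divisor with a general linear `ℙ^p` has degree `d`. -/
def Distribution.HasDegree {n r : ℕ} (D : Distribution n r) (d : ℕ) : Prop :=
  ∃ (p : ℕ) (l : ℤ) (ω : TwistedForm n p l), r + p = n ∧ D.GivenBy ω ∧ ω.TangencyDegree d

end ProjDist

end

/-!
Let `α` be the twisted `p`-form defining `F`, `p = n - k`, and `β` the twisted `1`-form defining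
`G`.
Pulled back to `ℂ^{n+1}`, their coefficients are homogeneous polynomials of degrees `deg F + 1` and
`deg G + 1` (`TwistedForm.TangencyDegree.sub_eq`, `exists_mvPolynomial_of_homogeneous`). At a point
which is regular for both distributions the inclusion `F ⊂ G` says that `β` is a linear combination
of the linear factors of `α`, so `β ∧ α = 0` there. Such points are dense: the singular set of a
full subsheaf has empty interior, and `Sing G` lies in a hypersurface. Hence `β ∧ α = 0`
everywhere (`sum_form_mul_form_eq_zero`).

The zeros of `β` other than the origin lie on the cone over `Sing G`, which has codimension at least
`p + 1`. The division lemma of de Rham and Saito then gives `α = β ∧ θ`, so the coefficients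
of `α` lie in the ideal generated by those of `β`, and comparing degrees gives `deg G ≤ deg F`.

Division is carried out on a linear subspace `W` of dimension at least `p + 1` that misses the cone
over `Sing G` and passes through a point where `α` does not vanish; `W` is cut out by linear forms
found by prime avoidance (`exists_submodule_disjoint_cone`). Restricting the coefficients, but not
the arguments, of `α` and `β` to `W`, the coefficients of `β` have the origin as their only common
zero, so by the Nullstellensatz the coordinates of `W`, which form a regular sequence of length at
least `p + 1`, lie in the radical of the ideal they generate. This suffices for the vanishing of the
Koszul cohomology of `β` in degree `p` (`mem_coboundaries_of_isWeaklyRegular`).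
-/

noncomputable section

namespace ProjDist

/-! ### Koszul cohomology -/

section Koszul

open scoped Pointwise

variable {k R E M N : Type*} [Field k] [CommRing R] [Algebra k R] [AddCommGroup E] [Module k E]
  [AddCommGroup M] [Module R M] [Module k M] [IsScalarTower k R M]
  [AddCommGroup N] [Module R N] [Module k N] [IsScalarTower k R N]

instance isScalarTower_alternatingMap {i : ℕ} : IsScalarTower k R (E [⋀^Fin i]→ₗ[k] M) :=
  ⟨fun a b B => AlternatingMap.ext fun v => smul_assoc a b (B v)⟩

/-- The wedge product `ω ∧ B` of an `R`-valued linear form `ω` on the `k`-vector space `E` with an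
alternating form `B` on `E` with values in an `R`-module `M`. It is the differential of the Koszul
cochain complex of `ω` with coefficients in `M`. -/
def wedge (ω : E →ₗ[k] R) {i : ℕ} :
    (E [⋀^Fin i]→ₗ[k] M) →ₗ[R] (E [⋀^Fin (i + 1)]→ₗ[k] M) where
  toFun B := AlternatingMap.alternatizeUncurryFin (ω.smulRight B)
  map_add' B C := by
    ext v
    simp [AlternatingMap.alternatizeUncurryFin_apply, Finset.sum_add_distrib]
  map_smul' c B := by
    ext v
    simp [AlternatingMap.alternatizeUncurryFin_apply, Finset.smul_sum, smul_comm _ c]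

theorem wedge_apply (ω : E →ₗ[k] R) {i : ℕ} (B : E [⋀^Fin i]→ₗ[k] M) (v : Fin (i + 1) → E) :
    wedge ω B v = ∑ j : Fin (i + 1), (-1) ^ (j : ℕ) • ω (v j) • B (j.removeNth v) := by
  simp [wedge, AlternatingMap.alternatizeUncurryFin_apply]

theorem wedge_wedge (ω : E →ₗ[k] R) {i : ℕ} (B : E [⋀^Fin i]→ₗ[k] M) :
    wedge ω (wedge ω B) = 0 := by
  let f : E →ₗ[k] E →ₗ[k] E [⋀^Fin i]→ₗ[k] M :=
    LinearMap.mk₂ k (fun x y => ω x • ω y • B) (by intros; simp [add_smul])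
      (by intros; simp [smul_assoc]) (by intros; simp [add_smul])
      (fun c x y => by simp [smul_comm (ω x) c])
  have h := AlternatingMap.alternatizeUncurryFin_alternatizeUncurryFinLM_comp_of_symmetric
    (f := f) (fun x y => smul_comm (ω x) (ω y) B)
  rw [← h]
  ext v
  simp only [wedge_apply, AlternatingMap.alternatizeUncurryFin_apply, LinearMap.comp_apply,
    AlternatingMap.alternatizeUncurryFinLM_apply, f, LinearMap.mk₂_apply, AlternatingMap.smul_apply,
    Finset.smul_sum]
  refine Finset.sum_congr rfl fun a _ => Finset.sum_congr rfl fun b _ => ?_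
  rw [smul_comm (ω (v a)) ((-1 : ℤ) ^ (b : ℕ))]

/-- The change of coefficients of a form along an `R`-linear map commutes with the wedge product. -/
theorem compAlternatingMap_wedge (ω : E →ₗ[k] R) (f : M →ₗ[R] N) {i : ℕ}
    (B : E [⋀^Fin i]→ₗ[k] M) :
    (f.restrictScalars k).compAlternatingMap (wedge ω B) =
      wedge ω ((f.restrictScalars k).compAlternatingMap B) := by
  ext v
  simp [wedge_apply]

/-- The coboundaries of degree `i` of the Koszul cochain complex of `ω`. -/
def coboundaries (ω : E →ₗ[k] R) (M : Type*) [AddCommGroup M] [Module R M] [Module k M]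
    [IsScalarTower k R M] : ∀ i : ℕ, Submodule R (E [⋀^Fin i]→ₗ[k] M)
  | 0 => ⊥
  | _ + 1 => LinearMap.range (wedge ω)

/-- Contraction with a vector `e` is a homotopy between zero and multiplication by `ω e`. -/
theorem smul_mem_coboundaries_of_wedge_eq_zero (ω : E →ₗ[k] R) {i : ℕ} {B : E [⋀^Fin i]→ₗ[k] M}
    (hB : wedge ω B = 0) (e : E) : ω e • B ∈ coboundaries ω M i := by
  cases i with
  | zero =>
    change _ = _
    ext v
    have := congrArg (fun C => C (Fin.cons e v)) hB
    simpa [wedge_apply] using this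
  | succ i =>
    refine ⟨B.curryLeft e, ?_⟩
    ext v
    have := congrArg (fun C => C (Fin.cons e v)) hB
    rw [wedge_apply, Fin.sum_univ_succ] at this
    simp only [Fin.cons_zero, Fin.cons_succ, Fin.val_zero, pow_zero,
      one_smul, Fin.val_succ, AlternatingMap.zero_apply, pow_succ, mul_neg, mul_one] at this
    simp only [wedge_apply, AlternatingMap.curryLeft_apply_apply, AlternatingMap.smul_apply]
    rw [Fin.removeNth_zero, Fin.tail_cons] at this
    rw [eq_neg_of_add_eq_zero_left this, ← Finset.sum_neg_distrib]
    refine Finset.sum_congr rfl fun j _ => ?_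
    rw [neg_smul, neg_neg]
    congr 3
    funext a
    refine Fin.cases ?_ (fun a => ?_) a
    · simp [Fin.removeNth]
    · simp [Fin.removeNth]

theorem smul_mem_coboundaries (ω : E →ₗ[k] R) {i : ℕ} {B : E [⋀^Fin i]→ₗ[k] M}
    (hB : wedge ω B = 0) {c : R} (hc : c ∈ Ideal.span (Set.range ω)) :
    c • B ∈ coboundaries ω M i := by
  induction hc using Submodule.span_induction with
  | mem x hx => obtain ⟨e, rfl⟩ := hx; exact smul_mem_coboundaries_of_wedge_eq_zero ω hB e
  | zero => simp
  | add x y _ _ hx hy => rw [add_smul]; exact add_mem hx hy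
  | smul a x _ hx => rw [smul_eq_mul, mul_smul]; exact Submodule.smul_mem _ _ hx

/-- A form whose values vanish modulo the nonzerodivisor `x` is divisible by `x`. -/
theorem exists_eq_smul_of_mkQ_comp_eq_zero {x : R} (hx : IsSMulRegular M x) {i : ℕ}
    (B : E [⋀^Fin i]→ₗ[k] M)
    (hB : (((x • (⊤ : Submodule R M)).mkQ).restrictScalars k).compAlternatingMap B = 0) :
    ∃ C : E [⋀^Fin i]→ₗ[k] M, B = x • C := by
  let m : M →ₗ[k] M := (LinearMap.lsmul R M x).restrictScalars k
  have hm : Function.Injective m := hx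
  have hmem : ∀ v, B v ∈ LinearMap.range m := by
    intro v
    have h := congrArg (fun C => C v) hB
    simp only [LinearMap.compAlternatingMap_apply, LinearMap.coe_restrictScalars,
      AlternatingMap.zero_apply, Submodule.mkQ_apply, Submodule.Quotient.mk_eq_zero] at h
    obtain ⟨y, -, hy⟩ := h
    exact ⟨y, hy⟩
  refine ⟨((LinearEquiv.ofInjective m hm).symm : LinearMap.range m →ₗ[k] M).compAlternatingMap
    (B.codRestrict (LinearMap.range m) hmem), ?_⟩
  ext v
  have h := LinearEquiv.apply_symm_apply (LinearEquiv.ofInjective m hm) ⟨B v, hmem v⟩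
  exact (congrArg Subtype.val h).symm

theorem exists_lift_mkQ (P : Submodule R M) {i : ℕ} (B : E [⋀^Fin i]→ₗ[k] (M ⧸ P)) :
    ∃ C : E [⋀^Fin i]→ₗ[k] M, (P.mkQ.restrictScalars k).compAlternatingMap C = B := by
  obtain ⟨s, hs⟩ := (P.mkQ.restrictScalars k).exists_rightInverse_of_surjective
    (LinearMap.range_eq_top.2 P.mkQ_surjective)
  refine ⟨s.compAlternatingMap B, ?_⟩
  ext v
  exact LinearMap.congr_fun hs (B v)

/-- If `x` is a nonzerodivisor on `M` and the cocycles with values in `M / x M` are coboundaries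
one degree below, then `x` is a nonzerodivisor on the Koszul cohomology of `M`. -/
theorem mem_coboundaries_of_smul_mem (ω : E →ₗ[k] R) {x : R} (hx : IsSMulRegular M x) {i : ℕ}
    (hq : ∀ j, j < i → ∀ B : E [⋀^Fin j]→ₗ[k] (QuotSMulTop x M), wedge ω B = 0 →
      B ∈ coboundaries ω (QuotSMulTop x M) j)
    {C : E [⋀^Fin i]→ₗ[k] M} (hC : x • C ∈ coboundaries ω M i) : C ∈ coboundaries ω M i := by
  have reg : ∀ {a : ℕ} {C D : E [⋀^Fin a]→ₗ[k] M}, x • C = x • D → C = D := by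
    intro a C D h
    ext v
    exact hx (congrArg (fun F => F v) h)
  cases i with
  | zero =>
    change _ = _ at hC
    change _ = _
    exact reg (by simpa using hC)
  | succ j =>
    obtain ⟨θ, hθ⟩ := hC
    have hcoc : wedge ω (((x • (⊤ : Submodule R M)).mkQ.restrictScalars k).compAlternatingMap θ)
        = 0 := by
      rw [← compAlternatingMap_wedge, hθ]
      ext v
      exact (Submodule.Quotient.mk_eq_zero _).2
        (Submodule.smul_mem_pointwise_smul (C v) x (⊤ : Submodule R M) trivial)
    have hb := hq j j.lt_succ_self _ hcoc
    -- modulo `x`, the primitive `θ` of `x • C` is exact; so up to a coboundary it is divisible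
    obtain ⟨ζ, hζ⟩ : ∃ ζ, wedge ω θ = x • wedge ω ζ := by
      cases j with
      | zero =>
        obtain ⟨ζ, rfl⟩ := exists_eq_smul_of_mkQ_comp_eq_zero hx θ hb
        exact ⟨ζ, map_smul _ _ _⟩
      | succ j =>
        obtain ⟨η', hη'⟩ := hb
        obtain ⟨η, rfl⟩ := exists_lift_mkQ _ η'
        obtain ⟨ζ, hζ⟩ := exists_eq_smul_of_mkQ_comp_eq_zero hx (θ - wedge ω η) (by
          erw [← compAlternatingMap_wedge] at hη'
          ext v
          have := congrArg (fun F => F v) hη'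
          simpa [sub_eq_zero] using this.symm)
        refine ⟨ζ, ?_⟩
        rw [sub_eq_iff_eq_add.1 hζ, map_add, wedge_wedge, map_smul, add_zero]
    exact ⟨ζ, reg (by rw [← hζ, hθ])⟩

/-- **Vanishing of Koszul cohomology below the depth.** If the radical of the ideal generated by
the values of `ω` contains a weakly `M`-regular sequence of length `r`, then the Koszul cocycles
with values in `M` of degree less than `r` are coboundaries. -/
theorem mem_coboundaries_of_isWeaklyRegular (ω : E →ₗ[k] R) (rs : List R)
    (hrad : ∀ r ∈ rs, r ∈ (Ideal.span (Set.range ω)).radical) :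
    ∀ (M : Type*) [AddCommGroup M] [Module R M] [Module k M] [IsScalarTower k R M],
      RingTheory.Sequence.IsWeaklyRegular M rs → ∀ i, i < rs.length →
      ∀ B : E [⋀^Fin i]→ₗ[k] M, wedge ω B = 0 → B ∈ coboundaries ω M i := by
  induction rs with
  | nil => intro M _ _ _ _ _ i hi; simp at hi
  | cons x rs ih =>
    intro M _ _ _ _ hreg i hi B hB
    obtain ⟨hx, hrs⟩ := (RingTheory.Sequence.isWeaklyRegular_cons_iff M x rs).1 hreg
    have hq : ∀ j, j < i → ∀ B : E [⋀^Fin j]→ₗ[k] (QuotSMulTop x M), wedge ω B = 0 →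
        B ∈ coboundaries ω (QuotSMulTop x M) j := fun j hj =>
      ih (fun r hr => hrad r (List.mem_cons_of_mem _ hr)) _ hrs j (by simp at hi; omega)
    obtain ⟨K, hK⟩ := hrad x List.mem_cons_self
    have hmem := smul_mem_coboundaries ω hB hK
    clear hK
    -- a power of `x` kills the class of `B`, and `x` is a nonzerodivisor on cohomology
    induction K with
    | zero => simpa using hmem
    | succ K ihK =>
      refine ihK (mem_coboundaries_of_smul_mem ω hx hq ?_)
      rwa [smul_smul, ← pow_succ']

theorem apply_mem_span_of_mem_coboundaries (ω : E →ₗ[k] R) {i : ℕ} {B : E [⋀^Fin i]→ₗ[k] R}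
    (hB : B ∈ coboundaries ω R i) (v : Fin i → E) : B v ∈ Ideal.span (Set.range ω) := by
  cases i with
  | zero =>
    change B = 0 at hB
    simp [hB]
  | succ i =>
    obtain ⟨θ, rfl⟩ := hB
    rw [wedge_apply]
    refine sum_mem fun j _ => zsmul_mem ?_ _
    exact Ideal.mul_mem_right _ _ (Ideal.subset_span (Set.mem_range_self (v j)))

end Koszul

/-! ### Ideals of polynomial rings -/

section MvPolynomial

open MvPolynomial

variable {k : Type*} [Field k]

/-- The variables form a regular sequence in a polynomial ring. -/
theorem isWeaklyRegular_X (m : ℕ) :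
    RingTheory.Sequence.IsWeaklyRegular (MvPolynomial (Fin m) k)
      (List.ofFn fun i : Fin m => (X i : MvPolynomial (Fin m) k)) := by
  rw [RingTheory.Sequence.isWeaklyRegular_iff_Fin]
  intro i
  have hi : (i : ℕ) < m := by simpa using i.2
  have hspan : Ideal.ofList ((List.ofFn fun i : Fin m => (X i : MvPolynomial (Fin m) k)).take i)
      = Ideal.span (X '' {j : Fin m | (j : ℕ) < i}) := by
    unfold Ideal.ofList
    congr 1
    ext x
    simp only [Set.mem_ofPred_eq, Set.mem_image, List.mem_take_iff_getElem, List.getElem_ofFn,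
      List.length_ofFn]
    constructor
    · rintro ⟨j, hj, rfl⟩
      exact ⟨⟨j, by omega⟩, by simp; omega, rfl⟩
    · rintro ⟨j, hj, rfl⟩
      exact ⟨j, by omega, rfl⟩
  rw [isSMulRegular_quotient_iff_mem_of_smul_mem]
  intro f hf
  rw [hspan, smul_eq_mul, Ideal.mul_top] at hf ⊢
  rw [mem_ideal_span_X_image] at hf ⊢
  intro a ha
  obtain ⟨j, hj, hne⟩ := hf (a + Finsupp.single ⟨i, hi⟩ 1) (by
    simpa [mem_support_iff, mul_comm (X _) f] using ha)
  refine ⟨j, hj, ?_⟩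
  have : (⟨i, hi⟩ : Fin m) ≠ j := by
    rintro rfl
    simp at hj
  simpa [Finsupp.single_apply, this] using hne

/-- A nonzero homogeneous element of an ideal generated by homogeneous polynomials of degree `a`
has degree at least `a`. -/
theorem le_degree_of_mem_span {σ : Type*} {s : Set (MvPolynomial σ k)} {a b : ℕ}
    (hs : ∀ f ∈ s, f.IsHomogeneous a) {q : MvPolynomial σ k} (hq : q ∈ Ideal.span s)
    (hqb : q.IsHomogeneous b) (h0 : q ≠ 0) : a ≤ b := by
  have key : ∀ d, q.coeff d ≠ 0 → a ≤ d.degree := by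
    clear hqb h0
    induction hq using Submodule.span_induction with
    | mem x hx =>
      intro d hd
      have := hs x hx hd
      rw [show (1 : σ → ℕ) = fun _ => 1 from rfl, ← Finsupp.degree_eq_weight_one] at this
      exact this.ge
    | zero => simp
    | add x y _ _ hx hy =>
      intro d hd
      by_cases h : x.coeff d = 0
      · exact hy d (by simpa [h] using hd)
      · exact hx d h
    | smul c x _ hx =>
      intro d hd
      classical
      rw [smul_eq_mul, coeff_mul] at hd
      obtain ⟨⟨u, v⟩, huv, hne⟩ := Finset.exists_ne_zero_of_sum_ne_zero hd
      rw [Finset.HasAntidiagonal.mem_antidiagonal] at huv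
      have := hx v (right_ne_zero_of_mul hne)
      simp only at huv
      rw [← huv, map_add]
      omega
  obtain ⟨d, hd⟩ := ne_zero_iff.1 h0
  have := hqb hd
  rw [show (1 : σ → ℕ) = fun _ => 1 from rfl, ← Finsupp.degree_eq_weight_one] at this
  have h2 := key d hd
  exact this ▸ h2

end MvPolynomial

/-! ### Linear sections of cones -/

section Sections

open MvPolynomial

variable {N : ℕ}

/-- A linear form on `ℂ^N` as a polynomial. -/
def linPoly : Module.Dual ℂ (Fin N → ℂ) →ₗ[ℂ] MvPolynomial (Fin N) ℂ :=
  ∑ i, LinearMap.smulRight (LinearMap.applyₗ (Pi.single i (1 : ℂ))) (X i)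

theorem aeval_linPoly {A : Type*} [CommRing A] [Algebra ℂ A] (φ : Module.Dual ℂ (Fin N → ℂ))
    (z : Fin N → ℂ) (t : A) : aeval (fun i => z i • t) (linPoly φ) = φ z • t := by
  have h : z = ∑ i, z i • (Pi.single i (1 : ℂ) : Fin N → ℂ) := by
    ext j
    simp [Finset.sum_apply, Pi.single_apply]
  conv_rhs => rw [h]
  simp [linPoly, LinearMap.sum_apply, Finset.sum_smul, smul_smul, mul_comm]

/-- The homogeneous prime ideal of the polynomials vanishing on the line `ℂ z`. -/
def lineIdeal (z : Fin N → ℂ) : Ideal (MvPolynomial (Fin N) ℂ) :=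
  RingHom.ker (aeval fun i => z i • (Polynomial.X : Polynomial ℂ))

instance isPrime_lineIdeal (z : Fin N → ℂ) : (lineIdeal z).IsPrime := RingHom.ker_isPrime _

theorem linPoly_mem_lineIdeal {z : Fin N → ℂ} {φ : Module.Dual ℂ (Fin N → ℂ)} :
    linPoly φ ∈ lineIdeal z ↔ φ z = 0 := by
  rw [lineIdeal, RingHom.mem_ker, aeval_linPoly]
  simp [smul_eq_zero]

theorem eval_aeval_smul_X (f : MvPolynomial (Fin N) ℂ) (z : Fin N → ℂ) (t : ℂ) :
    (aeval (fun i => z i • (Polynomial.X : Polynomial ℂ)) f).eval t = eval (t • z) f := by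
  have h : (Polynomial.aeval t).comp (aeval fun i => z i • (Polynomial.X : Polynomial ℂ)) =
      aeval (t • z) := by
    ext i
    simp [mul_comm]
  have h' := DFunLike.congr_fun h f
  rwa [AlgHom.comp_apply, Polynomial.coe_aeval_eq_eval, aeval_eq_eval] at h'

/-- The ideal of a line `ℂ z` with `z ≠ 0` is strictly contained in the ideal of the origin, so its
height is less than the dimension `N` of the polynomial ring. -/
theorem height_lineIdeal_lt {z : Fin N → ℂ} (hz : z ≠ 0) : (lineIdeal z).height < N := by
  have hlt : lineIdeal z < lineIdeal (0 : Fin N → ℂ) := by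
    refine lt_of_le_of_ne (fun f hf => ?_) fun h => ?_
    · have hf0 : eval (0 : Fin N → ℂ) f = 0 := by
        have := eval_aeval_smul_X f z 0
        rw [show aeval (fun i => z i • (Polynomial.X : Polynomial ℂ)) f = 0 from hf] at this
        simpa using this.symm
      change aeval (fun i => (0 : Fin N → ℂ) i • (Polynomial.X : Polynomial ℂ)) f = 0
      apply Polynomial.funext
      intro t
      rw [eval_aeval_smul_X, smul_zero, hf0, Polynomial.eval_zero]
    · obtain ⟨i, hi⟩ := Function.ne_iff.1 hz
      have : linPoly (LinearMap.proj i : Module.Dual ℂ (Fin N → ℂ)) ∈ lineIdeal z := by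
        rw [h, linPoly_mem_lineIdeal, map_zero]
      exact hi (linPoly_mem_lineIdeal.1 this)
  have h1 := Ideal.height_add_one_le_of_lt_of_isPrime hlt
  have h2 : ((lineIdeal (0 : Fin N → ℂ)).height : WithBot ℕ∞) ≤
      ringKrullDim (MvPolynomial (Fin N) ℂ) := Ideal.height_le_ringKrullDim_of_isPrime
  rw [MvPolynomial.ringKrullDim_of_isNoetherianRing, ringKrullDim_eq_zero_of_field] at h2
  have h3 : (lineIdeal (0 : Fin N → ℂ)).height ≤ (N : ℕ∞) := by
    rw [Nat.card_eq_fintype_card, Fintype.card_fin, zero_add] at h2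
    exact WithBot.coe_le_coe.1 h2
  have h4 := h1.trans h3
  exact (ENat.add_one_le_iff (by
    intro h
    rw [h] at h4
    simp at h4)).1 h4

theorem vanishingIdeal_le_lineIdeal {X : Set (Fin N → ℂ)}
    (hcone : ∀ c : ℂ, c ≠ 0 → ∀ z ∈ X, c • z ∈ X) {z : Fin N → ℂ} (hz : z ∈ X) :
    vanishingIdeal ℂ X ≤ lineIdeal z := by
  intro f hf
  have h : Polynomial.X * aeval (fun i => z i • (Polynomial.X : Polynomial ℂ)) f = 0 := by
    apply Polynomial.funext
    intro t
    rw [Polynomial.eval_mul, eval_aeval_smul_X, Polynomial.eval_X, Polynomial.eval_zero]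
    by_cases ht : t = 0
    · rw [ht, zero_mul]
    · have := mem_vanishingIdeal_iff.1 hf _ (hcone t ht z hz)
      rw [aeval_eq_eval] at this
      rw [show eval (t • z) f = 0 from this, mul_zero]
  exact (mul_eq_zero.1 h).resolve_left Polynomial.X_ne_zero

/-- Prime avoidance for linear forms: each further linear form vanishing at `z₀` can be chosen to
raise the height of the primes that contain it, as long as these primes do not contain all the
linear forms vanishing at `z₀`. -/
theorem exists_submodule_dual (I : Ideal (MvPolynomial (Fin N) ℂ)) {h : ℕ}
    (hI : (h : ℕ∞) ≤ I.height) (z₀ : Fin N → ℂ) (j : ℕ) :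
    ∃ U : Submodule ℂ (Module.Dual ℂ (Fin N → ℂ)), Module.finrank ℂ U ≤ j ∧ (∀ φ ∈ U, φ z₀ = 0) ∧
      ∀ P : Ideal (MvPolynomial (Fin N) ℂ), P.IsPrime → I ≤ P → (∀ φ ∈ U, linPoly φ ∈ P) →
        (∃ φ : Module.Dual ℂ (Fin N → ℂ), φ z₀ = 0 ∧ linPoly φ ∉ P) →
        ((h + j : ℕ) : ℕ∞) ≤ P.height := by
  induction j with
  | zero =>
    refine ⟨⊥, by simp, by simp, fun P _ hIP _ _ => ?_⟩
    exact hI.trans (Ideal.height_mono hIP)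
  | succ j ih =>
    obtain ⟨U, hUj, hU0, hU⟩ := ih
    let J := I ⊔ Ideal.span (linPoly '' (U : Set (Module.Dual ℂ (Fin N → ℂ))))
    have hJ : ∀ P : Ideal (MvPolynomial (Fin N) ℂ), J ≤ P ↔ I ≤ P ∧ ∀ φ ∈ U, linPoly φ ∈ P := by
      intro P
      rw [sup_le_iff, Ideal.span_le, Set.image_subset_iff]
      rfl
    let Z : Submodule ℂ (Module.Dual ℂ (Fin N → ℂ)) := LinearMap.ker (LinearMap.applyₗ z₀)
    obtain ⟨φ, hφ0, hφ⟩ : ∃ φ : Module.Dual ℂ (Fin N → ℂ), φ z₀ = 0 ∧ ∀ P ∈ J.minimalPrimes,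
        (∃ ψ : Module.Dual ℂ (Fin N → ℂ), ψ z₀ = 0 ∧ linPoly ψ ∉ P) → linPoly φ ∉ P := by
      by_contra! hcon
      let T := {P : Ideal (MvPolynomial (Fin N) ℂ) // P ∈ J.minimalPrimes ∧
        ∃ ψ : Module.Dual ℂ (Fin N → ℂ), ψ z₀ = 0 ∧ linPoly ψ ∉ P}
      have : Finite T := ((Ideal.finite_minimalPrimes_of_isNoetherianRing _ J).subset
        (fun P hP => hP.1)).to_subtype
      let p : T → Submodule ℂ Z := fun P =>
        (P.1.restrictScalars ℂ).comap (linPoly ∘ₗ Z.subtype)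
      obtain ⟨⟨P, hP, ψ, hψ0, hψ⟩, hPtop⟩ : ∃ i, p i = ⊤ := by
        apply Subspace.exists_eq_top_of_iUnion_eq_univ
        rw [Set.eq_univ_iff_forall]
        rintro ⟨φ, hφ⟩
        obtain ⟨P, hP, hψ, hφP⟩ := hcon φ hφ
        exact Set.mem_iUnion.2 ⟨⟨P, hP, hψ⟩, hφP⟩
      have : (⟨ψ, hψ0⟩ : Z) ∈ p ⟨P, hP, ψ, hψ0, hψ⟩ := by rw [hPtop]; trivial
      exact hψ this
    refine ⟨U ⊔ Submodule.span ℂ {φ}, ?_, ?_, ?_⟩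
    · refine (Submodule.finrank_add_le_finrank_add_finrank _ _).trans ?_
      exact add_le_add hUj (by simpa using finrank_span_le_card (R := ℂ) ({φ} : Set _))
    · intro ψ hψ
      have : U ⊔ Submodule.span ℂ {φ} ≤ Z := by
        rw [sup_le_iff, Submodule.span_singleton_le_iff_mem]
        exact ⟨hU0, hφ0⟩
      exact this hψ
    · intro P hP hIP hUP hψ
      have hJP : J ≤ P := (hJ P).2 ⟨hIP, fun ψ hψ => hUP ψ (Submodule.mem_sup_left hψ)⟩
      obtain ⟨Q, hQ, hQP⟩ := Ideal.exists_minimalPrimes_le hJP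
      have hQprime : Q.IsPrime := hQ.1.1
      obtain ⟨hIQ, hUQ⟩ := (hJ Q).1 hQ.1.2
      have hψQ : ∃ ψ : Module.Dual ℂ (Fin N → ℂ), ψ z₀ = 0 ∧ linPoly ψ ∉ Q :=
        hψ.imp fun ψ h => ⟨h.1, fun hm => h.2 (hQP hm)⟩
      have hlt : Q < P := lt_of_le_of_ne hQP fun h => hφ Q hQ hψQ (h ▸ hUP φ
        (Submodule.mem_sup_right (Submodule.mem_span_singleton_self φ)))
      have h1 := hU Q hQprime hIQ hUQ hψQ
      have h2 := Ideal.height_add_one_le_of_lt_of_isPrime hlt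
      refine le_trans ?_ h2
      rw [← add_assoc, Nat.cast_add, Nat.cast_one]
      gcongr

/-- A cone whose ideal has height at least `h` is missed by a linear subspace of dimension at least
`h`, through any prescribed point outside the cone. -/
theorem exists_submodule_disjoint_cone {X : Set (Fin N → ℂ)}
    (hcone : ∀ c : ℂ, c ≠ 0 → ∀ z ∈ X, c • z ∈ X) (h0 : (0 : Fin N → ℂ) ∉ X) {h : ℕ} (hN : h ≤ N)
    (hX : (h : ℕ∞) ≤ (vanishingIdeal ℂ X).height) {z₀ : Fin N → ℂ} (hz₀ : z₀ ∉ X) :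
    ∃ W : Submodule ℂ (Fin N → ℂ), z₀ ∈ W ∧ h ≤ Module.finrank ℂ W ∧ ∀ z ∈ W, z ∉ X := by
  obtain ⟨U, hUj, hU0, hU⟩ := exists_submodule_dual (vanishingIdeal ℂ X) hX z₀ (N - h)
  refine ⟨U.dualCoannihilator, (Submodule.mem_dualCoannihilator _).2 hU0, ?_, fun z hzW hzX => ?_⟩
  · have h1 := Subspace.finrank_add_finrank_dualCoannihilator_eq U
    rw [Module.finrank_fin_fun] at h1
    omega
  · have hz : z ≠ 0 := fun h => h0 (h ▸ hzX)
    have hzspan : z ∉ Submodule.span ℂ {z₀} := by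
      intro hm
      obtain ⟨c, rfl⟩ := Submodule.mem_span_singleton.1 hm
      have hc : c ≠ 0 := fun h => hz (by rw [h, zero_smul])
      exact hz₀ (by simpa [smul_smul, hc] using hcone c⁻¹ (inv_ne_zero hc) _ hzX)
    obtain ⟨φ, hφz, hφ⟩ := Submodule.exists_le_ker_of_notMem hzspan
    have h1 := hU (lineIdeal z) inferInstance (vanishingIdeal_le_lineIdeal hcone hzX)
      (fun ψ hψ => linPoly_mem_lineIdeal.2 ((Submodule.mem_dualCoannihilator _).1 hzW ψ hψ))
      ⟨φ, hφ (Submodule.mem_span_singleton_self z₀), fun hm => hφz (linPoly_mem_lineIdeal.1 hm)⟩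
    rw [Nat.add_sub_cancel' hN] at h1
    exact absurd (height_lineIdeal_lt hz) (not_lt.2 h1)

end Sections

/-! ### Homogeneous analytic functions -/

section Homogeneous

open MvPolynomial Filter

/-- Two entire functions `φ`, `ψ` with `ψ s = s ^ d * φ (1 / s)` are polynomials with reversed
coefficients; in particular `ψ 0` is the coefficient of degree `d` of `φ`. -/
theorem eq_coeff_of_eq_pow_mul_inv (d : ℕ) : ∀ {φ ψ : ℂ → ℂ} {p : FormalMultilinearSeries ℂ ℂ ℂ},
    Differentiable ℂ φ → Differentiable ℂ ψ → HasFPowerSeriesAt φ p 0 →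
    (∀ s, s ≠ 0 → ψ s = s ^ d * φ s⁻¹) → ψ 0 = p.coeff d := by
  induction d with
  | zero =>
    intro φ ψ p hφ hψ hp h
    have hlim : Tendsto φ (cocompact ℂ) (𝓝 (ψ 0)) := by
      have h1 : Tendsto (fun t : ℂ => ψ t⁻¹) (cocompact ℂ) (𝓝 (ψ 0)) :=
        (hψ.continuous.tendsto 0).comp (tendsto_inv₀_cobounded.mono_left
          Metric.cobounded_eq_cocompact.ge)
      refine h1.congr' ?_
      have : ∀ᶠ t : ℂ in cocompact ℂ, t ≠ 0 := by
        exact (isCompact_singleton (x := (0 : ℂ))).compl_mem_cocompact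
      filter_upwards [this] with t ht
      simpa using h t⁻¹ (inv_ne_zero ht)
    rw [← hφ.apply_eq_of_tendsto_cocompact 0 hlim, ← hp.coeff_zero (fun _ => 1)]
    rfl
  | succ d ih =>
    intro φ ψ p hφ hψ hp h
    have hdiff : Differentiable ℂ (dslope φ 0) := by
      have := (Complex.differentiableOn_dslope (s := Set.univ) (c := (0 : ℂ)) (f := φ)
        Filter.univ_mem).2 hφ.differentiableOn
      exact differentiableOn_univ.1 this
    have hψ' : Differentiable ℂ (fun s => ψ s - s ^ (d + 1) * φ 0) :=
      hψ.sub ((differentiable_id.pow _).mul_const _)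
    have := ih hdiff hψ' hp.has_fpower_series_dslope_fslope (fun s hs => by
      rw [dslope_of_ne _ (inv_ne_zero hs), slope_def_field, h s hs]
      field_simp
      ring)
    simpa using this

variable {m : ℕ}

/-- The polynomial `z ↦ q (z, …, z)` attached to a multilinear form `q` on `ℂ^m`. -/
def diagPoly {d : ℕ} (q : MultilinearMap ℂ (fun _ : Fin d => Fin m → ℂ) ℂ) :
    MvPolynomial (Fin m) ℂ :=
  ∑ v : Fin d → Fin m, C (q fun a => Pi.single (v a) 1) * ∏ a, X (v a)

theorem eval_diagPoly {d : ℕ} (q : MultilinearMap ℂ (fun _ : Fin d => Fin m → ℂ) ℂ)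
    (z : Fin m → ℂ) : eval z (diagPoly q) = q fun _ => z := by
  have h : z = ∑ i, z i • (Pi.single i (1 : ℂ) : Fin m → ℂ) := by
    ext j
    simp [Finset.sum_apply, Pi.single_apply]
  conv_rhs => rw [h]
  rw [q.map_sum]
  simp [diagPoly, q.map_smul_univ, mul_comm, map_prod]

theorem isHomogeneous_diagPoly {d : ℕ} (q : MultilinearMap ℂ (fun _ : Fin d => Fin m → ℂ) ℂ) :
    (diagPoly q).IsHomogeneous d := by
  refine IsHomogeneous.sum _ _ _ fun v _ => ?_
  have h := IsHomogeneous.prod (R := ℂ) (Finset.univ : Finset (Fin d)) (fun a => X (v a))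
    (fun _ => 1) (fun a _ => isHomogeneous_X _ _)
  simpa using (isHomogeneous_C (Fin m) (q fun a => Pi.single (v a) 1)).mul h

/-- A homogeneous function that is analytic away from the origin of `ℂ^m`, `m ≥ 2`, is a
homogeneous polynomial. On a vector `z` it is the term of degree `d`, at `z`, of the power series at
any base point `e` outside the line `ℂ z`. -/
theorem exists_mvPolynomial_of_homogeneous (hm : 2 ≤ m) {d : ℕ} {f : (Fin m → ℂ) → ℂ}
    (hf : ∀ z, z ≠ 0 → AnalyticAt ℂ f z)
    (hhom : ∀ (c : ℂ) z, c ≠ 0 → z ≠ 0 → f (c • z) = c ^ d * f z) :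
    ∃ P : MvPolynomial (Fin m) ℂ, P.IsHomogeneous d ∧ ∀ z, z ≠ 0 → eval z P = f z := by
  let e : Fin m → ℂ := Pi.single ⟨0, by omega⟩ 1
  let e' : Fin m → ℂ := Pi.single ⟨1, by omega⟩ 1
  have he : e ≠ 0 := by simp [e]
  obtain ⟨p, hp⟩ := hf e he
  refine ⟨diagPoly (p d).toMultilinearMap, isHomogeneous_diagPoly _, ?_⟩
  -- the identity at the vectors outside the line spanned by the base point
  have key : ∀ z, z ∉ Submodule.span ℂ {e} → eval z (diagPoly (p d).toMultilinearMap) = f z := by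
    intro z hz
    have h1 : ∀ t : ℂ, e + t • z ≠ 0 := by
      intro t ht
      have ht0 : t ≠ 0 := by
        rintro rfl
        exact he (by simpa using ht)
      apply hz
      refine Submodule.mem_span_singleton.2 ⟨-t⁻¹, ?_⟩
      rw [eq_neg_of_add_eq_zero_left ht, smul_neg, neg_smul, neg_neg, smul_smul,
        inv_mul_cancel₀ ht0, one_smul]
    have h2 : ∀ s : ℂ, z + s • e ≠ 0 := by
      intro s hs
      exact hz (Submodule.mem_span_singleton.2
        ⟨-s, by rw [eq_neg_of_add_eq_zero_left hs, neg_smul]⟩)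
    have hφ : Differentiable ℂ (fun t : ℂ => f (e + t • z)) := fun t =>
      (hf _ (h1 t)).differentiableAt.comp t (by fun_prop)
    have hψ : Differentiable ℂ (fun s : ℂ => f (z + s • e)) := fun s =>
      (hf _ (h2 s)).differentiableAt.comp s (by fun_prop)
    let u : ℂ →L[ℂ] (Fin m → ℂ) := ContinuousLinearMap.toSpanSingleton ℂ z
    have hser : HasFPowerSeriesAt (fun t : ℂ => f (e + t • z)) (p.compContinuousLinearMap u) 0 := by
      have h3 : HasFPowerSeriesAt (fun y => f (e + y)) p (u 0) := by
        rw [map_zero]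
        simpa [add_comm] using hp.comp_sub (-e)
      exact h3.compContinuousLinearMap
    have := eq_coeff_of_eq_pow_mul_inv d hφ hψ hser (fun s hs => by
      rw [← hhom s _ hs (h1 _), smul_add, smul_smul, mul_inv_cancel₀ hs, one_smul, add_comm])
    rw [eval_diagPoly]
    simp only [zero_smul, add_zero] at this
    rw [this]
    simp only [FormalMultilinearSeries.coeff, FormalMultilinearSeries.compContinuousLinearMap_apply]
    change p d _ = p d _
    congr 1
    funext a
    simp [u]
  intro z hz
  by_cases hze : z ∈ Submodule.span ℂ {e}
  · -- on the line itself the identity follows by continuity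
    have hev : ∀ t : ℂ, t ≠ 0 → z + t • e' ∉ Submodule.span ℂ {e} := by
      intro t ht hmem
      have h4 : t • e' ∈ Submodule.span ℂ {e} := by
        simpa using Submodule.sub_mem _ hmem hze
      obtain ⟨c, hc⟩ := Submodule.mem_span_singleton.1 h4
      have := congrFun hc ⟨1, by omega⟩
      simp [e, e'] at this
      exact ht this.symm
    have hline : Tendsto (fun t : ℂ => z + t • e') (𝓝[≠] 0) (𝓝 z) := by
      have : Continuous fun t : ℂ => z + t • e' := by fun_prop
      simpa using (this.tendsto 0).mono_left nhdsWithin_le_nhds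
    have hA : Tendsto (fun t : ℂ => f (z + t • e')) (𝓝[≠] 0) (𝓝 (f z)) :=
      (hf z hz).continuousAt.tendsto.comp hline
    have hB : Tendsto (fun t : ℂ => eval (z + t • e') (diagPoly (p d).toMultilinearMap)) (𝓝[≠] 0)
        (𝓝 (eval z (diagPoly (p d).toMultilinearMap))) :=
      ((MvPolynomial.continuous_eval _).tendsto z).comp hline
    refine tendsto_nhds_unique hB (hA.congr' ?_)
    filter_upwards [self_mem_nhdsWithin] with t ht
    exact (key _ (hev t ht)).symm
  · exact key z hze

end Homogeneous

/-! ### Density of the regular points -/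

section Density

open MvPolynomial Filter

variable {n : ℕ}

/-- If `E` is full, its singular set has empty interior: every vector field on an open subset of
the singular set is a section of `E`, so there the normal sheaf vanishes and is free. -/
theorem Subsheaf.IsFull.dense_compl_sing {E : Subsheaf n} (hE : E.IsFull) : Dense E.Singᶜ := by
  rw [dense_iff_inter_open]
  rintro U hU ⟨x, hx⟩
  by_contra hempty
  have hsub : ∀ y ∈ U, y ∈ E.Sing := by
    intro y hy
    by_contra hyS
    exact hempty ⟨y, hy, hyS⟩
  refine hsub x hx ⟨⟨U, hU⟩, 0, Fin.elim0, hx, fun W hWU hxW σ => ?_, fun W _ hxW f _ => ?_⟩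
  · exact ⟨W, le_rfl, Fin.elim0, hxW,
      hE W _ fun y hy hyS => absurd (hsub y (hWU hy)) hyS⟩
  · exact ⟨W, le_rfl, hxW, fun i => i.elim0⟩

/-- The projection `ℂ^{n+1} \ {0} → ℙⁿ` is open, so dense sets meet the images of open sets. -/
theorem exists_mk_mem_of_dense {S : Set (Pn n)} (hS : Dense S) {O : Set (V n)} (hO : IsOpen O)
    (hne : O.Nonempty) (h0 : (0 : V n) ∉ O) :
    ∃ z ∈ O, ∃ hz : z ≠ 0, Projectivization.mk ℂ z hz ∈ S := by
  let O' : Set (Pn n) := {x | ∃ z ∈ O, ∃ hz : z ≠ 0, Projectivization.mk ℂ z hz = x}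
  have hO' : IsOpen O' := by
    refine isOpen_coinduced.2 ?_
    have : (fun z : {z : V n // z ≠ 0} => Projectivization.mk' ℂ z) ⁻¹' O' =
        ⋃ c : {c : ℂ // c ≠ 0}, {w | c.1 • w.1 ∈ O} := by
      ext ⟨w, hw⟩
      simp only [Set.mem_preimage, Projectivization.mk'_eq_mk, Set.mem_iUnion, Set.mem_ofPred_eq,
        O', Projectivization.mk_eq_mk_iff']
      constructor
      · rintro ⟨z, hz, hz0, a, rfl⟩
        exact ⟨⟨a, fun h => hz0 (by rw [h, zero_smul])⟩, hz⟩
      · rintro ⟨⟨a, ha⟩, h⟩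
        exact ⟨a • w, h, smul_ne_zero ha hw, a, rfl⟩
    rw [this]
    refine isOpen_iUnion fun c => hO.preimage ?_
    exact (continuous_subtype_val (p := fun z : V n => z ≠ 0)).const_smul c.1
  obtain ⟨z, hz⟩ := hne
  have hz0 : z ≠ 0 := fun h => h0 (h ▸ hz)
  obtain ⟨x, ⟨w, hw, hw0, rfl⟩, hxS⟩ := hS.inter_open_nonempty O' hO'
    ⟨Projectivization.mk ℂ z hz0, z, hz, hz0, rfl⟩
  exact ⟨w, hw, hw0, hxS⟩

theorem frequently_eval_ne_zero {m : ℕ} {q : MvPolynomial (Fin m) ℂ} (hq : q ≠ 0)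
    (z : Fin m → ℂ) : ∃ᶠ w in 𝓝 z, eval w q ≠ 0 := by
  intro h
  have h' : (fun w => eval w q) =ᶠ[𝓝 z] 0 := by
    filter_upwards [h] with w hw
    simpa using hw
  have hA : AnalyticOnNhd ℂ (fun w => eval w q) Set.univ := AnalyticOnNhd.eval_mvPolynomial q
  have := hA.eqOn_zero_of_preconnected_of_eventuallyEq_zero isPreconnected_univ (Set.mem_univ z) h'
  exact hq (MvPolynomial.funext fun w => by simpa using this (Set.mem_univ w))

theorem mvPolynomial_ext_of_ne_zero {m : ℕ} (hm : 0 < m) {P Q : MvPolynomial (Fin m) ℂ}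
    (h : ∀ w, w ≠ 0 → eval w P = eval w Q) : P = Q := by
  refine mul_left_cancel₀ (X_ne_zero (R := ℂ) (⟨0, hm⟩ : Fin m)) (MvPolynomial.funext fun w => ?_)
  by_cases hw : w = 0
  · simp [hw]
  · rw [map_mul, map_mul, h w hw]

end Density

/-! ### Twisted forms -/

section Forms

open MvPolynomial Filter

variable {n p : ℕ} {l : ℤ}

theorem det_cons_single (w : Fin (p + 1) → ℂ) :
    Matrix.det (Matrix.of (Fin.cons w fun j : Fin p => Pi.single j.succ 1 :
      Fin (p + 1) → Fin (p + 1) → ℂ)) = w 0 := by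
  rw [Matrix.det_of_isUpperTriangular]
  · rw [Fin.prod_univ_succ]
    simp
  · intro i j hij
    cases i using Fin.cases with
    | zero => exact absurd hij (by simp)
    | succ i =>
      have : j ≠ i.succ := ne_of_lt hij
      simp [this]

theorem eval_smul_of_isHomogeneous {σ : Type*} {g : MvPolynomial σ ℂ} {d : ℕ}
    (hg : g.IsHomogeneous d) (c : ℂ) (w : σ → ℂ) : eval (c • w) g = c ^ d * eval w g := by
  rw [eval_eq, eval_eq, Finset.mul_sum]
  refine Finset.sum_congr rfl fun a ha => ?_
  have h := hg (mem_support_iff.1 ha)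
  rw [show (1 : σ → ℕ) = fun _ => 1 from rfl, ← Finsupp.degree_eq_weight_one,
    Finsupp.degree_apply] at h
  simp only [Pi.smul_apply, smul_eq_mul, mul_pow, Finset.prod_mul_distrib,
    Finset.prod_pow_eq_pow_sum, h]
  ring

/-- The tangency degree determines the degree of the coefficients of a twisted form; and such a
form does not vanish identically. -/
theorem TwistedForm.TangencyDegree.sub_eq {ω : TwistedForm n p l} {d : ℕ}
    (h : ω.TangencyDegree d) :
    l - p = (d + 1 : ℕ) ∧ ∃ z : V n, z ≠ 0 ∧ ∃ u, ω.form z u ≠ 0 := by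
  obtain ⟨P, hP, hA⟩ := h
  obtain ⟨a, ha⟩ : ∃ a, eval a P ≠ 0 := by
    by_contra! hcon
    exact hP (MvPolynomial.funext fun a => by simpa using hcon a)
  obtain ⟨hinj, g, hg, hgd, hform⟩ := hA (Matrix.of fun i j => a (i, j)) ha
  set A : Matrix (Fin (n + 1)) (Fin (p + 1)) ℂ := Matrix.of fun i j => a (i, j)
  obtain ⟨w, hw⟩ : ∃ w, eval w (X 0 * g) ≠ 0 := by
    by_contra! hcon
    exact mul_ne_zero (X_ne_zero 0) hg (MvPolynomial.funext fun a => by simpa using hcon a)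
  rw [map_mul, eval_X] at hw
  have hw0 : w 0 ≠ 0 := left_ne_zero_of_mul hw
  have hgw : eval w g ≠ 0 := right_ne_zero_of_mul hw
  have hwne : w ≠ 0 := fun h => hw0 (by simp [h])
  have hAw : A.mulVec w ≠ 0 := fun h => hwne (hinj (by simpa using h))
  have h1 := hform w (fun j => Pi.single j.succ 1) hwne
  rw [det_cons_single] at h1
  have h2 := hform ((2 : ℂ) • w) (fun j => Pi.single j.succ 1) (smul_ne_zero two_ne_zero hwne)
  rw [det_cons_single, Matrix.mulVec_smul, ω.homogeneous 2 _ two_ne_zero hAw,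
    AlternatingMap.smul_apply, h1, eval_smul_of_isHomogeneous hgd] at h2
  refine ⟨?_, _, hAw, _, h1 ▸ mul_ne_zero hgw hw0⟩
  have h3 : (2 : ℂ) ^ (l - p) = 2 ^ ((d + 1 : ℕ) : ℤ) := by
    refine mul_right_cancel₀ (mul_ne_zero hgw hw0) ?_
    rw [← smul_eq_mul, h2, zpow_natCast]
    simp only [Pi.smul_apply, smul_eq_mul]
    ring
  have h4 : (2 : ℝ) ^ (l - p) = 2 ^ ((d + 1 : ℕ) : ℤ) := by
    have h5 := congrArg norm h3
    rwa [norm_zpow, norm_zpow, Complex.norm_ofNat] at h5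
  exact zpow_right_injective₀ (by norm_num) (by norm_num) h4

/-- The restriction to a linear subspace of the coefficients of a twisted form, as an alternating
form with polynomial values. -/
theorem TwistedForm.exists_polynomial_form (ω : TwistedForm n p l) {d : ℕ} (hl : l - p = (d : ℕ))
    {m : ℕ} (hm : 2 ≤ m) (L : (Fin m → ℂ) →ₗ[ℂ] V n) (hL : Function.Injective L) :
    ∃ B : V n [⋀^Fin p]→ₗ[ℂ] MvPolynomial (Fin m) ℂ, (∀ u, (B u).IsHomogeneous d) ∧
      ∀ w, w ≠ 0 → ∀ u, eval w (B u) = ω.form (L w) u := by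
  have hL0 : ∀ w, w ≠ 0 → L w ≠ 0 := fun w hw h => hw (hL (by rw [h, map_zero]))
  have hex : ∀ u : Fin p → V n, ∃ P : MvPolynomial (Fin m) ℂ, P.IsHomogeneous d ∧
      ∀ w, w ≠ 0 → eval w P = ω.form (L w) u := by
    intro u
    refine exists_mvPolynomial_of_homogeneous hm (fun z hz => ?_) (fun c z hc hz => ?_)
    · exact (ω.analytic (L z) (hL0 z hz) u).comp (f := L)
        (L.toContinuousLinearMap.analyticAt z)
    · rw [map_smul, ω.homogeneous c _ hc (hL0 z hz), hl, zpow_natCast]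
      rfl
  choose B hB hBe using hex
  have hext : ∀ {P Q : MvPolynomial (Fin m) ℂ}, (∀ w, w ≠ 0 → eval w P = eval w Q) → P = Q :=
    fun h => mvPolynomial_ext_of_ne_zero (by omega) h
  refine ⟨{ toFun := B, map_update_add' := ?_, map_update_smul' := ?_, map_eq_zero_of_eq' := ?_ },
    hB, fun w hw u => hBe u w hw⟩
  · intro _ u i x y
    refine hext fun w hw => ?_
    rw [map_add, hBe _ w hw, hBe _ w hw, hBe _ w hw, AlternatingMap.map_update_add]
  · intro _ u i c x
    refine hext fun w hw => ?_
    rw [smul_eval, hBe _ w hw, hBe _ w hw, AlternatingMap.map_update_smul, smul_eq_mul]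
  · intro u i j hij hne
    refine hext fun w hw => ?_
    rw [hBe _ w hw, map_zero, AlternatingMap.map_eq_zero_of_eq _ u hij hne]

/-- A linear form vanishing on the common kernel of `φ₁, …, φ_p` has zero wedge product with
`φ₁ ∧ ⋯ ∧ φ_p`. -/
theorem sum_mul_det_eq_zero {E : Type*} [AddCommGroup E] [Module ℂ E] (φ : Fin p → Module.Dual ℂ E)
    (ψ : Module.Dual ℂ E) (h : ∀ y, (∀ i, φ i y = 0) → ψ y = 0) (u : Fin (p + 1) → E) :
    ∑ j : Fin (p + 1), (-1) ^ (j : ℕ) * ψ (u j) *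
      Matrix.det (Matrix.of fun i j' => φ i (j.removeNth u j')) = 0 := by
  have hmem : ψ ∈ Submodule.span ℂ (Set.range φ) := by
    refine mem_span_of_iInf_ker_le_ker fun y hy => ?_
    rw [Submodule.mem_iInf] at hy
    exact h y hy
  obtain ⟨a, ha⟩ := (Submodule.mem_span_range_iff_exists_fun ℂ).1 hmem
  let M : Matrix (Fin (p + 1)) (Fin (p + 1)) ℂ :=
    Matrix.of (Fin.cons (fun j => ψ (u j)) fun i j => φ i (u j))
  have hM : M.det = 0 := by
    refine Matrix.exists_vecMul_eq_zero_iff.1 ⟨Fin.cons (-1) a, fun h => ?_, ?_⟩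
    · simpa using congrFun h 0
    · ext j
      have hj := congrArg (fun χ => χ (u j)) ha
      simp only [LinearMap.sum_apply, LinearMap.smul_apply, smul_eq_mul] at hj
      simp [M, Matrix.vecMul, dotProduct, Fin.sum_univ_succ, hj]
  rw [Matrix.det_succ_row_zero] at hM
  rw [← hM]
  refine Finset.sum_congr rfl fun j _ => ?_
  rfl

end Forms

/-! ### Flags -/

section Flags

open MvPolynomial Filter

variable {n p r s : ℕ} {l l' : ℤ}

theorem exists_mem_vanishingIdeal_ne_zero {S : Set (Pn n)} (hS : 1 ≤ codim S) :
    ∃ q ∈ vanishingIdeal ℂ {z : V n | ∃ hz : z ≠ 0, Projectivization.mk ℂ z hz ∈ S}, q ≠ 0 := by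
  refine (Submodule.ne_bot_iff _).1 fun h => ?_
  rw [codim, h, Ideal.height_bot] at hS
  exact absurd hS (by simp)

/-- At a common regular point of a flag `F ⊂ G` with `G` of codimension one, the linear form
defining `G` vanishes on the common kernel of the linear forms defining `F`. -/
theorem sum_form_mul_form_eq_zero_of_notMem_sing {F : Distribution n r} {G : Distribution n s}
    (hflag : IsFlag F G) {α : TwistedForm n p l} {β : TwistedForm n 1 l'} (hα : F.GivenBy α)
    (hβ : G.GivenBy β) {z : V n} (hz : z ≠ 0) (hF : Projectivization.mk ℂ z hz ∉ F.Sing)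
    (hG : Projectivization.mk ℂ z hz ∉ G.Sing) (u : Fin (p + 1) → V n) :
    ∑ j : Fin (p + 1), (-1) ^ (j : ℕ) * β.form z (fun _ => u j) * α.form z (j.removeNth u) = 0 := by
  obtain ⟨φ, -, hφ, hFφ⟩ := hα z hz hF
  obtain ⟨ψ, -, hψ, hGψ⟩ := hβ z hz hG
  have hker : ∀ y, (∀ i, φ i y = 0) → ψ 0 y = 0 := by
    intro y hy
    -- the tangent vector at the line `ℂ z` represented by `y`
    have hmem : z ∈ (Projectivization.mk ℂ z hz).submodule := by
      rw [Projectivization.submodule_mk]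
      exact Submodule.mem_span_singleton_self z
    obtain ⟨t, ht⟩ : ∃ t : Tan (Projectivization.mk ℂ z hz), Lifts t z y := by
      obtain ⟨f, hf⟩ := Module.Projective.exists_dual_eq_one ℂ
        (x := (⟨z, hmem⟩ : (Projectivization.mk ℂ z hz).submodule))
        fun h => hz (congrArg Subtype.val h)
      refine ⟨f.smulRight (Submodule.Quotient.mk y), hmem, ?_⟩
      rw [LinearMap.smulRight_apply, hf, one_smul]
    have htF := (hFφ t y ht).2 hy
    obtain ⟨U, hx, σ, hσ, hσt⟩ := htF
    exact (hGψ t y ht).1 ⟨U, hx, σ, hflag.2.2.2 U hσ, hσt⟩ 0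
  rw [← sum_mul_det_eq_zero φ (ψ 0) hker u]
  refine Finset.sum_congr rfl fun j _ => ?_
  rw [hφ, hψ]
  simp

/-- For a flag `F ⊂ G` of reduced distributions with `G` of codimension one, the wedge product of
the forms defining `G` and `F` vanishes identically: the common regular points are dense. -/
theorem sum_form_mul_form_eq_zero {F : Distribution n r} {G : Distribution n s}
    (hflag : IsFlag F G) (hF : F.IsReduced) (hG : 1 ≤ codim G.Sing) {α : TwistedForm n p l}
    {β : TwistedForm n 1 l'} (hα : F.GivenBy α) (hβ : G.GivenBy β) {z : V n} (hz : z ≠ 0)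
    (u : Fin (p + 1) → V n) :
    ∑ j : Fin (p + 1), (-1) ^ (j : ℕ) * β.form z (fun _ => u j) * α.form z (j.removeNth u) = 0 := by
  obtain ⟨q, hq, hq0⟩ := exists_mem_vanishingIdeal_ne_zero hG
  by_contra hne
  have hcont : ContinuousAt (fun w => ∑ j : Fin (p + 1), (-1) ^ (j : ℕ) *
      β.form w (fun _ => u j) * α.form w (j.removeNth u)) z :=
    tendsto_finsetSum _ fun j _ => ((((continuousAt_const).mul
      (β.analytic z hz _).continuousAt).mul (α.analytic z hz _).continuousAt) :)
  have hev := (hcont.eventually_ne hne).and (eventually_ne_nhds hz)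
  obtain ⟨O, hO, hOo, hzO⟩ := eventually_nhds_iff.1 hev
  obtain ⟨w, hw, hw0, hwF⟩ := exists_mk_mem_of_dense (Subsheaf.IsFull.dense_compl_sing hF)
    (O := O ∩ {w | eval w q ≠ 0})
    (hOo.inter (isOpen_ne_fun (MvPolynomial.continuous_eval q) continuous_const))
    (by
      obtain ⟨w, h1, h2⟩ := ((frequently_eval_ne_zero hq0 z).and_eventually
        (hOo.mem_nhds hzO)).exists
      exact ⟨w, h2, h1⟩)
    (fun h => (hO 0 h.1).2 rfl)
  refine (hO w hw.1).1 (sum_form_mul_form_eq_zero_of_notMem_sing hflag hα hβ hw0 hwF (fun hwG => ?_)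
    u)
  exact hw.2 (mem_vanishingIdeal_iff.1 hq w ⟨hw0, hwG⟩)

/-- The degree inequality, in terms of the forms `α` and `β` defining `F` and `G`. On a linear
subspace `W` that meets the cone over `Sing G` only in the origin the Koszul complex of `β` is exact
in degree `p`, so there `α` is divisible by `β`. -/
theorem le_of_flag {F : Distribution n r} {G : Distribution n s} (hflag : IsFlag F G)
    (hF : F.IsReduced) (hp : 1 ≤ p) (hpn : p ≤ n)
    (hcodim : ((p + 1 : ℕ) : ℕ∞) ≤ codim G.Sing)
    {α : TwistedForm n p l} {β : TwistedForm n 1 l'} (hα : F.GivenBy α) (hβ : G.GivenBy β)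
    {a b : ℕ} (ha : l' - (1 : ℕ) = a) (hb : l - p = b)
    (hα0 : ∃ z : V n, z ≠ 0 ∧ ∃ u, α.form z u ≠ 0) : a ≤ b := by
  have hcodim1 : 1 ≤ codim G.Sing := le_trans (by norm_cast; omega) hcodim
  have hwedge := fun {z : V n} (hz : z ≠ 0) => sum_form_mul_form_eq_zero hflag hF hcodim1 hα hβ hz
  let S : Set (V n) := {z : V n | ∃ hz : z ≠ 0, Projectivization.mk ℂ z hz ∈ G.Sing}
  have hcone : ∀ c : ℂ, c ≠ 0 → ∀ z ∈ S, c • z ∈ S := by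
    rintro c hc z ⟨hz, hzG⟩
    refine ⟨smul_ne_zero hc hz, ?_⟩
    rwa [(Projectivization.mk_eq_mk_iff' ℂ _ _ (smul_ne_zero hc hz) hz).2 ⟨c, rfl⟩]
  have hS0 : (0 : V n) ∉ S := fun h => h.1 rfl
  obtain ⟨q, hq, hq0⟩ := exists_mem_vanishingIdeal_ne_zero hcodim1
  -- a point outside the cone over `Sing G` at which `α` does not vanish
  obtain ⟨z₀, hz₀, hz₀S, u, hu⟩ : ∃ z : V n, z ≠ 0 ∧ z ∉ S ∧ ∃ u, α.form z u ≠ 0 := by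
    obtain ⟨z, hz, u, hu⟩ := hα0
    obtain ⟨w, h1, h2, h3⟩ := ((frequently_eval_ne_zero hq0 z).and_eventually
      (((α.analytic z hz u).continuousAt.eventually_ne hu).and (eventually_ne_nhds hz))).exists
    exact ⟨w, h3, fun hwS => h1 (mem_vanishingIdeal_iff.1 hq w hwS), u, h2⟩
  obtain ⟨W, hz₀W, hWdim, hWS⟩ := exists_submodule_disjoint_cone (h := p + 1) hcone hS0 (by omega)
    hcodim hz₀S
  let m := Module.finrank ℂ W
  let e : (Fin m → ℂ) ≃ₗ[ℂ] W := (Module.finBasis ℂ W).equivFun.symm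
  let L : (Fin m → ℂ) →ₗ[ℂ] V n := W.subtype ∘ₗ e.toLinearMap
  have hL : Function.Injective L := W.injective_subtype.comp e.injective
  have hm : 2 ≤ m := by
    have : p + 1 ≤ m := hWdim
    omega
  have hL0 : ∀ w, w ≠ 0 → L w ≠ 0 := fun w hw h => hw (hL (by rw [h, map_zero]))
  obtain ⟨A, hAhom, hA⟩ := β.exists_polynomial_form ha hm L hL
  obtain ⟨B, hBhom, hB⟩ := α.exists_polynomial_form hb hm L hL
  let ω : V n →ₗ[ℂ] MvPolynomial (Fin m) ℂ := (AlternatingMap.ofSubsingleton ℂ (V n) _ 0).symm A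
  have hω : ∀ v, ω v = A fun _ => v := fun v => by
    simp [ω]
  have hcoc : wedge ω B = 0 := by
    ext1 v
    refine mvPolynomial_ext_of_ne_zero (by omega) fun w hw => ?_
    rw [AlternatingMap.zero_apply, map_zero, ← hwedge (hL0 w hw) v, wedge_apply, map_sum]
    refine Finset.sum_congr rfl fun j _ => ?_
    rw [hω, smul_eq_mul, zsmul_eq_mul, map_mul, map_mul, hA w hw, hB w hw]
    simp [mul_assoc]
  have hrad : ∀ x ∈ List.ofFn (fun i : Fin m => (X i : MvPolynomial (Fin m) ℂ)),
      x ∈ (Ideal.span (Set.range ω)).radical := by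
    intro x hx
    obtain ⟨i, rfl⟩ := List.mem_ofFn.1 hx
    rw [← vanishingIdeal_zeroLocus_eq_radical (K := ℂ), mem_vanishingIdeal_iff]
    intro w hw
    rw [aeval_X]
    -- the coefficients of `β` have no common zero on `W` besides the origin
    by_contra hwi
    have hw0 : w ≠ 0 := fun h => hwi (by rw [h, Pi.zero_apply])
    have hLS : Projectivization.mk ℂ (L w) (hL0 w hw0) ∉ G.Sing :=
      fun h => hWS (L w) (e w).2 ⟨_, h⟩
    obtain ⟨ψ, hψ, hψβ, -⟩ := hβ _ (hL0 w hw0) hLS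
    refine hψ.ne_zero 0 (LinearMap.ext fun v => ?_)
    have h1 : eval w (ω v) = 0 :=
      (mem_zeroLocus_iff.1 hw) _ (Ideal.subset_span ⟨v, rfl⟩)
    rw [hω, hA w hw0, hψβ] at h1
    simpa using h1
  have hcob := mem_coboundaries_of_isWeaklyRegular ω _ hrad _ (isWeaklyRegular_X m) p
    (by rw [List.length_ofFn]; exact hWdim) B hcoc
  have hBspan := apply_mem_span_of_mem_coboundaries ω hcob u
  have hBu : B u ≠ 0 := by
    intro h
    let w := e.symm ⟨z₀, hz₀W⟩
    have hLw : L w = z₀ := by simp [L, w]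
    have hw : w ≠ 0 := fun h => hz₀ (by rw [← hLw, h, map_zero])
    have h1 := hB w hw u
    rw [h, map_zero, hLw] at h1
    exact hu h1.symm
  refine le_degree_of_mem_span ?_ hBspan (hBhom u) hBu
  rintro _ ⟨v, rfl⟩
  rw [hω]
  exact hAhom _

end Flags

end ProjDist

end

theorem theorem2 (n k : ℕ) (F : ProjDist.Distribution n k) (G : ProjDist.Distribution n (n - 1))
    (hF : F.IsReduced) (hG : G.IsReduced) (hflag : ProjDist.IsFlag F G)
    (hcodim : ((n - k + 1 : ℕ) : ℕ∞) ≤ ProjDist.codim G.Sing)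
    (hsplit : F.tangentSheaf.IsSplit)
    (dF dG : ℕ) (hdF : F.HasDegree dF) (hdG : G.HasDegree dG) :
    dG ≤ dF := by
  obtain ⟨p, l, α, hp, hα, hαd⟩ := hdF
  obtain ⟨p', l', β, hp', hβ, hβd⟩ := hdG
  have hk := hflag.2.1
  obtain rfl : p' = 1 := by omega
  obtain ⟨hl, hα0⟩ := hαd.sub_eq
  obtain ⟨hl', -⟩ := hβd.sub_eq
  have h := ProjDist.le_of_flag hflag hF (by omega) (by omega)
    (by rwa [show p + 1 = n - k + 1 by omega]) hα hβ hl' hl hα0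
  omega
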